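/- Let $q$ be a complex number with $0<|q|<1$ and put $(u;q)_\infty=\prod_{j=0}^\infty(1-uq^j)$ and $(u_1,\dots,u_m;q)_\infty=(u_1;q)_\infty\cdots(u_m;q)_\infty$. For a function $f$ of $r\ge 1$ complex variables, the multiple Jackson $q$-integral is $$\int_{A_1}^{B_1}\!\!\cdots\int_{A_r}^{B_r} f(t_1,\dots,t_r)\,d_qt_r\cdots d_qt_1=\sum_{S\subseteq\{1,\dots,r\}}\Big(\prod_{i\in S}(-A_i)\Big)\Big(\prod_{i\notin S}B_i\Big)(1-q)^r\sum_{k_1,\dots,k_r=0}^\infty f\big(c_1(S)q^{k_1},\dots,c_r(S)q^{k_r}\big)\,q^{k_1+\dots+k_r},$$ where $c_i(S)=A_i$ if $i\in S$ and $c_i(S)=B_i$ if $i\notin S$. Let $a,b,x_1,\dots,x_r$ be nonzero complex numbers and $c,d\in\mathbb C$, such that none of $cx_i$, $-adx_i/b$ ($1\le i\le r$), $-bc/a$, $d$ equals $q^{-n}$ for an integer $n\ge0$ (so that no denominator below vanishes). Then all the multiple series that define the $q$-integral below converge absolutely, and $$\int_{-ax_1}^{b}\!\!\cdots\int_{-ax_r}^{b}\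 \prod_{1\le i<j\le r}(t_i-t_j)\prod_{i=1}^r\frac{(-qt_i/ax_i,\;qt_i/b;q)_\infty}{(-ct_i/a,\;dt_i/b;q)_\infty}\;d_qt_r\cdots d_qt_1$$ $$=(-a)^{\binom r2}b^r(1-q)^r\prod_{1\le i<j\le r}(x_i-x_j)\prod_{i=1}^r\frac{(q,\;-ax_i/b,\;-bq/ax_i,\;cdq^{r-1}x_i;q)_\infty}{(cx_i,\;-adx_i/b,\;-bcq^{i-1}/a,\;dq^{i-1};q)_\infty}.$$ -/

import Mathlib

/-- The infinite `q`-shifted factorial `(a; q)_∞ = ∏_{j ≥ 0} (1 - a q ^ j)`. -/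
noncomputable def qShiftedInf (q a : ℂ) : ℂ := ∏' j : ℕ, (1 - a * q ^ j)

/-- For a subset `S` of the coordinates, the point with coordinates `c_i(S) q ^ (k_i)`, where
`c_i(S) = A_i` if `i ∈ S` and `c_i(S) = B_i` if `i ∉ S`. -/
noncomputable def qNode {r : ℕ} (q : ℂ) (A B : Fin r → ℂ) (S : Finset (Fin r))
    (k : Fin r → ℕ) : Fin r → ℂ :=
  fun i => (if i ∈ S then A i else B i) * q ^ k i

/-- The `r`-fold Jackson `q`-integral
`∫_{A_1}^{B_1} ⋯ ∫_{A_r}^{B_r} f(t_1, …, t_r) d_q t_r ⋯ d_q t_1`, i.e. the sum over all subsets `S`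
of `{1, …, r}` of
`∏_{i ∈ S} (-A_i) ∏_{i ∉ S} B_i (1 - q)^r ∑_{k_1, …, k_r ≥ 0} f(c(S) q^k) q ^ (k_1 + ⋯ + k_r)`. -/
noncomputable def multiQIntegral {r : ℕ} (q : ℂ) (A B : Fin r → ℂ)
    (f : (Fin r → ℂ) → ℂ) : ℂ :=
  ∑ S : Finset (Fin r),
    (∏ i ∈ S, (-A i)) * (∏ i ∈ Sᶜ, B i) * (1 - q) ^ r *
      ∑' k : Fin r → ℕ, f (qNode q A B S k) * q ^ (∑ i, k i)

/-- Each of the `2 ^ r` multiple series that make up the `r`-fold Jackson `q`-integral converges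
absolutely. -/
def MultiQIntegrable {r : ℕ} (q : ℂ) (A B : Fin r → ℂ) (f : (Fin r → ℂ) → ℂ) : Prop :=
  ∀ S : Finset (Fin r),
    Summable fun k : Fin r → ℕ => ‖f (qNode q A B S k) * q ^ (∑ i, k i)‖

/-- The integrand
`∏_{i < j} (t_i - t_j) ∏_i (-q t_i / (a x_i), q t_i / b; q)_∞ / (-c t_i / a, d t_i / b; q)_∞`. -/
noncomputable def andrewsAskeyIntegrand {r : ℕ} (q a b c d : ℂ) (x t : Fin r → ℂ) : ℂ :=
  (∏ i, ∏ j ∈ Finset.Ioi i, (t i - t j)) *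
    ∏ i, (qShiftedInf q (-(q * t i) / (a * x i)) * qShiftedInf q (q * t i / b)) /
      (qShiftedInf q (-(c * t i) / a) * qShiftedInf q (d * t i / b))

/-! The Vandermonde product turns the integral into a determinant of one-variable integrals. Put `A
i = -a x_i`, `B = b`, `C = -c/a`, `D = d/b`. As the polynomials `qNodal q B j` are monic of degree
`j`, the integrand is, up to sign, the determinant of `qNodal q B j (t_i)` times the Andrews–Askey
weight in `t_i`. Row `i` involves only `t_i`, so integration passes inside (`multiQIntegral_det`).

The nodal polynomials suit the weight: multiplying by one amounts, up to a constant, to replacing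
`B` by `B q ^ j` (`jackson_qNodal_mul_aaWeight`). Each entry is then an Andrews–Askey integral: a
row factor, a column factor, and `A_i ^ j (A_i B C D q ^ j; q)_∞`. The last symbol is `(A_i B C D q
^ (r - 1); q)_∞` times a polynomial in `A_i` of degree at most `r - 1 - j` with constant term 1, so
a unitriangular change of basis leaves the Vandermonde determinant of the `A_i`
(`det_pow_mul_prod`).

The Andrews–Askey integral itself (`jackson_aaWeight`) comes from a first-order recurrence under `C
↦ C q`, iterated to reach `C = D = 0`. The constant is found by running the same relation from `C =
q/A`, `D = q/B`, where the weight is 1. -/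

open Filter Topology

/-! ### Infinite `q`-shifted factorials -/

section QShifted

variable {q : ℂ}

lemma summable_mul_qpow (hq : ‖q‖ < 1) (u : ℂ) : Summable fun j : ℕ => ‖-(u * q ^ j)‖ := by
  simp only [norm_neg, norm_mul, norm_pow]
  exact (summable_geometric_of_lt_one (norm_nonneg _) hq).mul_left _

lemma multipliable_qShifted (hq : ‖q‖ < 1) (u : ℂ) :
    Multipliable fun j : ℕ => (1 - u * q ^ j) := by
  simpa [sub_eq_add_neg] using multipliable_one_add_of_summable (summable_mul_qpow hq u)

lemma qShiftedInf_step (hq : ‖q‖ < 1) (u : ℂ) :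
    qShiftedInf q u = (1 - u) * qShiftedInf q (u * q) := by
  have e : ∀ j : ℕ, 1 - u * q * q ^ j = 1 - u * q ^ (j + 1) := fun j => by ring
  have h := multipliable_qShifted hq (u * q)
  simp only [e] at h
  have h1 := tprod_eq_zero_mul' (f := fun j : ℕ => 1 - u * q ^ j) h
  simp only [qShiftedInf, e]
  rw [h1, pow_zero, mul_one]

lemma qShiftedInf_eq_prod_mul (hq : ‖q‖ < 1) (u : ℂ) (n : ℕ) :
    qShiftedInf q u = (∏ k ∈ Finset.range n, (1 - u * q ^ k)) * qShiftedInf q (u * q ^ n) := by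
  induction n with
  | zero => simp
  | succ n ih =>
    rw [ih, Finset.prod_range_succ, qShiftedInf_step hq (u * q ^ n), pow_succ]
    ring_nf

lemma qShiftedInf_ne_zero (hq : ‖q‖ < 1) {u : ℂ} (hu : ∀ n : ℕ, u * q ^ n ≠ 1) :
    qShiftedInf q u ≠ 0 := by
  have := tprod_one_add_ne_zero_of_summable (f := fun j : ℕ => -(u * q ^ j))
    (fun j h => hu j (by linear_combination -h)) (summable_mul_qpow hq u)
  simpa [qShiftedInf, sub_eq_add_neg] using this

lemma qShiftedInf_zero_right (q : ℂ) : qShiftedInf q 0 = 1 := by simp [qShiftedInf]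

lemma qShiftedInf_eq_zero (hq : ‖q‖ < 1) {u : ℂ} {n : ℕ} (hu : u * q ^ n = 1) :
    qShiftedInf q u = 0 := by
  rw [qShiftedInf_eq_prod_mul hq u (n + 1), Finset.prod_range_succ, hu]
  simp

lemma tendsto_mul_qpow (hq : ‖q‖ < 1) (u : ℂ) :
    Tendsto (fun n : ℕ => u * q ^ n) atTop (𝓝 0) := by
  simpa using (tendsto_pow_atTop_nhds_zero_of_norm_lt_one hq).const_mul u

lemma tendsto_qShiftedInf_aux (hq : ‖q‖ < 1) {u : ℂ} (hu : ∀ n : ℕ, u * q ^ n ≠ 1) :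
    Tendsto (fun n : ℕ => qShiftedInf q (u * q ^ n)) atTop (𝓝 1) := by
  have h0 := qShiftedInf_ne_zero hq hu
  have h1 := (multipliable_qShifted hq u).hasProd.tendsto_prod_nat
  have h2 : Tendsto (fun n : ℕ => qShiftedInf q u / ∏ k ∈ Finset.range n, (1 - u * q ^ k)) atTop
      (𝓝 (qShiftedInf q u / qShiftedInf q u)) := tendsto_const_nhds.div h1 h0
  rw [div_self h0] at h2
  refine h2.congr fun n => ?_
  have hp : ∏ k ∈ Finset.range n, (1 - u * q ^ k) ≠ 0 :=
    Finset.prod_ne_zero_iff.2 fun k _ h => hu k (by linear_combination -h)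
  rw [qShiftedInf_eq_prod_mul hq u n]
  field_simp

lemma tendsto_qShiftedInf (hq : ‖q‖ < 1) (u : ℂ) :
    Tendsto (fun n : ℕ => qShiftedInf q (u * q ^ n)) atTop (𝓝 1) := by
  -- Since `u q ^ n → 0`, no factor vanishes from some index `N` on, and the limit sees only that
  -- tail.
  obtain ⟨N, hN⟩ := eventually_atTop.1
    ((tendsto_mul_qpow hq u).eventually_ne (zero_ne_one : (0 : ℂ) ≠ 1))
  have := tendsto_qShiftedInf_aux hq (u := u * q ^ N) fun n => by
    rw [mul_assoc, ← pow_add]; exact hN _ (by omega)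
  rw [← tendsto_add_atTop_iff_nat N]
  refine this.congr fun n => ?_
  rw [mul_assoc, ← pow_add, add_comm]

lemma tendsto_qShiftedInf_mul (hq : ‖q‖ < 1) (s u : ℂ) :
    Tendsto (fun n : ℕ => qShiftedInf q (s * (u * q ^ n))) atTop (𝓝 1) := by
  simpa [mul_assoc] using tendsto_qShiftedInf hq (s * u)

/-- The theta function `(z, q/z; q)_∞` is quasi-periodic under `z ↦ z/q`. -/
lemma theta_shift (hq0 : q ≠ 0) (hq : ‖q‖ < 1) {A B : ℂ} (hA : A ≠ 0) (hB : B ≠ 0) :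
    -(B * q) * (qShiftedInf q (A / (B * q)) * qShiftedInf q (B * q * q / A)) =
      A * (qShiftedInf q (A / B) * qShiftedInf q (B * q / A)) := by
  rw [qShiftedInf_step hq (A / (B * q)), qShiftedInf_step hq (B * q / A),
    show A / (B * q) * q = A / B by field_simp, show B * q / A * q = B * q * q / A by field_simp]
  field_simp
  ring

end QShifted

/-! ### One-variable Jackson integrals -/

section Jackson

variable {q : ℂ}

/-- The sum of `f` over the geometric orbit of `U`, weighted by the powers of `q`. -/
noncomputable def orbitSum (q U : ℂ) (f : ℂ → ℂ) : ℂ := ∑' k : ℕ, f (U * q ^ k) * q ^ k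

/-- The one-variable Jackson `q`-integral of `f` from `A` to `B`. -/
noncomputable def jackson (q A B : ℂ) (f : ℂ → ℂ) : ℂ :=
  (1 - q) * (B * orbitSum q B f - A * orbitSum q A f)

/-- `f` has a limit along the geometric orbit of `U`. -/
def HasOrbitLimit (q U : ℂ) (f : ℂ → ℂ) : Prop :=
  ∃ L, Tendsto (fun k : ℕ => f (U * q ^ k)) atTop (𝓝 L)

lemma HasOrbitLimit.mul {U : ℂ} {f g : ℂ → ℂ} (hf : HasOrbitLimit q U f)
    (hg : HasOrbitLimit q U g) : HasOrbitLimit q U fun t => f t * g t :=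
  let ⟨_, h⟩ := hf; let ⟨_, k⟩ := hg; ⟨_, h.mul k⟩

lemma HasOrbitLimit.of_continuous (hq : ‖q‖ < 1) {f : ℂ → ℂ} (hf : Continuous f) (U : ℂ) :
    HasOrbitLimit q U f :=
  ⟨_, (hf.tendsto 0).comp (tendsto_mul_qpow hq U)⟩

lemma HasOrbitLimit.summable_norm (hq : ‖q‖ < 1) {U : ℂ} {f : ℂ → ℂ} (hf : HasOrbitLimit q U f) :
    Summable fun k : ℕ => ‖f (U * q ^ k) * q ^ k‖ := by
  obtain ⟨L, hL⟩ := hf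
  obtain ⟨K, hK⟩ := hL.norm.bddAbove_range
  refine Summable.of_nonneg_of_le (fun _ => norm_nonneg _) (fun k => ?_)
    ((summable_geometric_of_lt_one (norm_nonneg q) hq).mul_left K)
  rw [norm_mul, norm_pow]
  gcongr
  exact hK ⟨k, rfl⟩

lemma HasOrbitLimit.summable (hq : ‖q‖ < 1) {U : ℂ} {f : ℂ → ℂ} (hf : HasOrbitLimit q U f) :
    Summable fun k : ℕ => f (U * q ^ k) * q ^ k :=
  (hf.summable_norm hq).of_norm

lemma orbitSum_congr {U : ℂ} {f g : ℂ → ℂ} (h : ∀ k : ℕ, f (U * q ^ k) = g (U * q ^ k)) :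
    orbitSum q U f = orbitSum q U g := by
  simp only [orbitSum, h]

lemma orbitSum_linear (hq : ‖q‖ < 1) {U : ℂ} {f g : ℂ → ℂ} (hf : HasOrbitLimit q U f)
    (hg : HasOrbitLimit q U g) (α β : ℂ) :
    orbitSum q U (fun t => α * f t + β * g t) = α * orbitSum q U f + β * orbitSum q U g := by
  simp only [orbitSum]
  rw [← tsum_mul_left, ← tsum_mul_left,
    ← ((hf.summable hq).mul_left α).tsum_add ((hg.summable hq).mul_left β)]
  exact tsum_congr fun k => by ring

lemma orbitSum_step (hq : ‖q‖ < 1) {U : ℂ} {f : ℂ → ℂ} (hf : HasOrbitLimit q U f) :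
    orbitSum q U f = f U + q * orbitSum q (U * q) f := by
  have h := (hf.summable hq).tsum_eq_zero_add
  simp only [orbitSum]
  rw [h, ← tsum_mul_left]
  congr 1
  · simp
  · exact tsum_congr fun k => by rw [pow_succ', mul_assoc U]; ring

lemma mul_orbitSum_telescope (hq : ‖q‖ < 1) {U L : ℂ} {h g : ℂ → ℂ} (hh : HasOrbitLimit q U h)
    (hg : Tendsto (fun k : ℕ => g (U * q ^ k)) atTop (𝓝 L))
    (e : ∀ k : ℕ, h (U * q ^ k) * (U * q ^ k) = g (U * q ^ k) - g (U * q ^ (k + 1))) :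
    U * orbitSum q U h = g U - L := by
  have h1 := ((hh.summable hq).mul_left U).hasSum.tendsto_sum_nat
  rw [tsum_mul_left] at h1
  refine tendsto_nhds_unique h1 ?_
  have h2 : Tendsto (fun n : ℕ => g U - g (U * q ^ n)) atTop (𝓝 (g U - L)) :=
    tendsto_const_nhds.sub hg
  refine h2.congr fun n => ?_
  rw [Finset.sum_congr rfl (g := fun k => g (U * q ^ k) - g (U * q ^ (k + 1)))
    (fun k _ => by rw [← e]; ring), Finset.sum_range_sub']
  simp

lemma jackson_congr {A B : ℂ} {f g : ℂ → ℂ} (hA : ∀ k : ℕ, f (A * q ^ k) = g (A * q ^ k))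
    (hB : ∀ k : ℕ, f (B * q ^ k) = g (B * q ^ k)) : jackson q A B f = jackson q A B g := by
  rw [jackson, jackson, orbitSum_congr hA, orbitSum_congr hB]

lemma jackson_linear (hq : ‖q‖ < 1) {A B : ℂ} {f g : ℂ → ℂ} (hfA : HasOrbitLimit q A f)
    (hfB : HasOrbitLimit q B f) (hgA : HasOrbitLimit q A g) (hgB : HasOrbitLimit q B g)
    (α β : ℂ) :
    jackson q A B (fun t => α * f t + β * g t) =
      α * jackson q A B f + β * jackson q A B g := by
  rw [jackson, jackson, jackson, orbitSum_linear hq hfA hgA, orbitSum_linear hq hfB hgB]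
  ring

lemma jackson_const_mul {A B : ℂ} (f : ℂ → ℂ) (α : ℂ) :
    jackson q A B (fun t => α * f t) = α * jackson q A B f := by
  simp only [jackson, orbitSum, mul_assoc, tsum_mul_left]
  ring

/-- If `f` vanishes at the upper limit `B`, that limit may be replaced by `B q`. -/
lemma jackson_shift (hq : ‖q‖ < 1) {A B : ℂ} {f : ℂ → ℂ} (hf : HasOrbitLimit q B f)
    (h0 : f B = 0) : jackson q A B f = jackson q A (B * q) f := by
  rw [jackson, jackson, orbitSum_step hq hf, h0]
  ring

/-! ### The Andrews–Askey integral -/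

/-- The Andrews–Askey weight `(q t / A, q t / B; q)_∞ / (C t, D t; q)_∞`. -/
noncomputable def aaWeight (q A B C D t : ℂ) : ℂ :=
  (qShiftedInf q (q * t / A) * qShiftedInf q (q * t / B)) /
    (qShiftedInf q (C * t) * qShiftedInf q (D * t))

lemma tendsto_qShiftedInf_orbit (hq : ‖q‖ < 1) (s U : ℂ) :
    Tendsto (fun n : ℕ => qShiftedInf q (U * q ^ n / s)) atTop (𝓝 1) := by
  simpa [div_eq_inv_mul] using tendsto_qShiftedInf_mul hq s⁻¹ U

lemma tendsto_aaWeight (hq : ‖q‖ < 1) (A B C D U : ℂ) :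
    Tendsto (fun k : ℕ => aaWeight q A B C D (U * q ^ k)) atTop (𝓝 1) := by
  have h (s : ℂ) : Tendsto (fun n : ℕ => qShiftedInf q (q * (U * q ^ n) / s)) atTop (𝓝 1) := by
    simpa [mul_assoc] using tendsto_qShiftedInf_orbit hq s (q * U)
  have := ((h A).mul (h B)).div
    ((tendsto_qShiftedInf_mul hq C U).mul (tendsto_qShiftedInf_mul hq D U)) (by simp)
  rw [mul_one, div_one] at this
  exact this

lemma hasOrbitLimit_aaWeight (hq : ‖q‖ < 1) (A B C D U : ℂ) :
    HasOrbitLimit q U (aaWeight q A B C D) :=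
  ⟨_, tendsto_aaWeight hq A B C D U⟩

lemma aaWeight_comm (q A B C D : ℂ) : aaWeight q A B C D = aaWeight q A B D C := by
  ext t; simp only [aaWeight]; ring

lemma aaWeight_mul_left (hq : ‖q‖ < 1) (A B : ℂ) {C : ℂ} (D : ℂ) {t : ℂ} (h : C * t ≠ 1) :
    aaWeight q A B (C * q) D t = (1 - C * t) * aaWeight q A B C D t := by
  have h1 : 1 - C * t ≠ 0 := fun e => h (by linear_combination -e)
  rw [aaWeight, aaWeight, qShiftedInf_step hq (C * t), show C * t * q = C * q * t by ring,
    mul_assoc (1 - C * t), ← mul_div_assoc, mul_div_mul_left _ _ h1]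

lemma aaWeight_shift (hq0 : q ≠ 0) (hq : ‖q‖ < 1) (A : ℂ) {B : ℂ} (C D t : ℂ) :
    aaWeight q A (B * q) C D t = (1 - t / B) * aaWeight q A B C D t := by
  rw [aaWeight, aaWeight, show q * t / (B * q) = t / B by field_simp, qShiftedInf_step hq (t / B),
    show t / B * q = q * t / B by ring]
  ring

/-- The `q`-integral of a total `q`-difference vanishes. -/
lemma mul_orbitSum_aaWeight (hq : ‖q‖ < 1) {A B C D U : ℂ} (hA : A ≠ 0) (hB : B ≠ 0)
    (hU : U = A ∨ U = B)
    (hC : ∀ n : ℕ, C * (U * q ^ n) ≠ 1) (hD : ∀ n : ℕ, D * (U * q ^ n) ≠ 1) :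
    U * orbitSum q U (fun t => (1 - A * B * C * D) * (t * aaWeight q A B C D t) +
      -(A + B - A * B * C - A * B * D) * aaWeight q A B C D t) = -(A * B) := by
  have hw := hasOrbitLimit_aaWeight hq A B C D U
  have hid : HasOrbitLimit q U fun t => t := .of_continuous hq continuous_id U
  have := mul_orbitSum_telescope (q := q) hq (U := U) (L := A * B * 1)
    (h := fun t => (1 - A * B * C * D) * (t * aaWeight q A B C D t) +
      -(A + B - A * B * C - A * B * D) * aaWeight q A B C D t)
    -- With `w` the weight, `g t = A B (1 - t/A) (1 - t/B) w t` and `g (q t) = A B (1 - C t) (1 - D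
    -- t) w t`; their difference is `t` times the summand. As `g` vanishes at `A` and at `B`, both
    -- endpoints give the same value, minus the limit `A B`.
    (g := fun t => A * B * ((qShiftedInf q (t / A) * qShiftedInf q (t / B)) /
      (qShiftedInf q (C * t) * qShiftedInf q (D * t)))) ?_ ?_ ?_
  · rw [this]
    have h1 : qShiftedInf q 1 = 0 := qShiftedInf_eq_zero hq (n := 0) (by simp)
    rcases hU with rfl | rfl
    · simp [hA, h1]
    · simp [hB, h1]
  · obtain ⟨L', hL'⟩ := hid.mul hw
    obtain ⟨L, hL⟩ := hw
    exact ⟨_, (hL'.const_mul _).add (hL.const_mul _)⟩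
  · refine Tendsto.const_mul _ ?_
    have := ((tendsto_qShiftedInf_orbit hq A U).mul (tendsto_qShiftedInf_orbit hq B U)).div
      ((tendsto_qShiftedInf_mul hq C U).mul (tendsto_qShiftedInf_mul hq D U)) (by simp)
    rw [mul_one, div_one] at this
    exact this
  · intro k
    have h1 := hC k
    have h2 := hD k
    have e : U * q ^ (k + 1) = q * (U * q ^ k) := by ring
    simp only [e]
    generalize U * q ^ k = t at *
    have h1' : 1 - C * t ≠ 0 := fun e => h1 (by linear_combination -e)
    have h2' : 1 - D * t ≠ 0 := fun e => h2 (by linear_combination -e)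
    rw [aaWeight, qShiftedInf_step hq (t / A), qShiftedInf_step hq (t / B),
      qShiftedInf_step hq (C * t), qShiftedInf_step hq (D * t),
      show t / A * q = q * t / A by ring, show t / B * q = q * t / B by ring,
      show C * t * q = C * (q * t) by ring, show D * t * q = D * (q * t) by ring]
    generalize qShiftedInf q (q * t / A) = a1
    generalize qShiftedInf q (q * t / B) = a2
    rw [mul_mul_mul_comm (1 - C * t), mul_mul_mul_comm (1 - t / A)]
    generalize qShiftedInf q (C * (q * t)) * qShiftedInf q (D * (q * t)) = a3
    -- If `a3 = 0`, every quotient is 0 by convention and the identity is trivial.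
    rcases eq_or_ne a3 0 with rfl | h3
    · simp
    field_simp
    ring

lemma jackson_aaWeight_moment (hq : ‖q‖ < 1) {A B C D : ℂ} (hA : A ≠ 0) (hB : B ≠ 0)
    (hAC : ∀ n : ℕ, A * C * q ^ n ≠ 1) (hAD : ∀ n : ℕ, A * D * q ^ n ≠ 1)
    (hBC : ∀ n : ℕ, B * C * q ^ n ≠ 1) (hBD : ∀ n : ℕ, B * D * q ^ n ≠ 1) :
    (1 - A * B * C * D) * jackson q A B (fun t => t * aaWeight q A B C D t) =
      (A + B - A * B * C - A * B * D) * jackson q A B (aaWeight q A B C D) := by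
  have e (X Y : ℂ) (h : ∀ n : ℕ, X * Y * q ^ n ≠ 1) (n : ℕ) : Y * (X * q ^ n) ≠ 1 := by
    rw [← mul_assoc, mul_comm Y]; exact h n
  have h1 := mul_orbitSum_aaWeight hq hA hB (.inl rfl) (e _ _ hAC) (e _ _ hAD)
  have h2 := mul_orbitSum_aaWeight hq hA hB (.inr rfl) (e _ _ hBC) (e _ _ hBD)
  have hw := hasOrbitLimit_aaWeight hq A B C D
  have hid (U : ℂ) : HasOrbitLimit q U fun t => t := .of_continuous hq continuous_id U
  have h3 := jackson_linear hq ((hid A).mul (hw A)) ((hid B).mul (hw B)) (hw A) (hw B)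
    (1 - A * B * C * D) (-(A + B - A * B * C - A * B * D))
  rw [jackson, h1, h2] at h3
  linear_combination -h3

/-- Replacing `C` by `C q` multiplies the weight by `1 - C t`, and the moment relation expresses the
integral of `t` times the weight through that of the weight. -/
lemma jackson_aaWeight_step (hq : ‖q‖ < 1) {A B C D : ℂ} (hA : A ≠ 0) (hB : B ≠ 0)
    (hAC : ∀ n : ℕ, A * C * q ^ n ≠ 1) (hAD : ∀ n : ℕ, A * D * q ^ n ≠ 1)
    (hBC : ∀ n : ℕ, B * C * q ^ n ≠ 1) (hBD : ∀ n : ℕ, B * D * q ^ n ≠ 1) :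
    (1 - A * B * C * D) * jackson q A B (aaWeight q A B (C * q) D) =
      (1 - A * C) * (1 - B * C) * jackson q A B (aaWeight q A B C D) := by
  have h1 := jackson_aaWeight_moment hq hA hB hAC hAD hBC hBD
  have hw := hasOrbitLimit_aaWeight hq A B C D
  have hid (U : ℂ) : HasOrbitLimit q U fun t => t := .of_continuous hq continuous_id U
  have h3 := jackson_linear hq (hw A) (hw B) ((hid A).mul (hw A)) ((hid B).mul (hw B)) 1 (-C)
  have h4 : jackson q A B (aaWeight q A B (C * q) D) = jackson q A B
      (fun t => 1 * aaWeight q A B C D t + -C * (t * aaWeight q A B C D t)) := by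
    refine jackson_congr (fun k => ?_) fun k => ?_
    · rw [aaWeight_mul_left hq A B D fun e => hAC k (by rw [← e]; ring)]; ring
    · rw [aaWeight_mul_left hq A B D fun e => hBC k (by rw [← e]; ring)]; ring
  rw [h4, h3]
  linear_combination (-C) * h1

/-- Dominated convergence: along the orbit, `C` enters only through `1 / (C U q ^ (n + k); q)_∞`, a
convergent, hence bounded, sequence in `n + k`. -/
lemma tendsto_orbitSum_aaWeight (hq : ‖q‖ < 1) (A B : ℂ) {C : ℂ} (D : ℂ) {U : ℂ} :
    Tendsto (fun n : ℕ => orbitSum q U (aaWeight q A B (C * q ^ n) D)) atTop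
      (𝓝 (orbitSum q U (aaWeight q A B 0 D))) := by
  have h1 : Tendsto (fun m : ℕ => (qShiftedInf q (C * U * q ^ m))⁻¹) atTop (𝓝 1) := by
    simpa using (tendsto_qShiftedInf hq (C * U)).inv₀ one_ne_zero
  obtain ⟨K, hK⟩ := h1.norm.bddAbove_range
  have e (n : ℕ) (t : ℂ) : aaWeight q A B (C * q ^ n) D t =
      aaWeight q A B 0 D t * (qShiftedInf q (C * q ^ n * t))⁻¹ := by
    simp only [aaWeight, zero_mul, qShiftedInf_zero_right]
    rw [div_eq_mul_inv, div_eq_mul_inv, mul_inv, one_mul]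
    ring
  refine tendsto_tsum_of_dominated_convergence
    (bound := fun k => ‖aaWeight q A B 0 D (U * q ^ k) * q ^ k‖ * K)
    (((hasOrbitLimit_aaWeight hq A B 0 D U).summable_norm hq).mul_right K) (fun k => ?_)
    (.of_forall fun n k => ?_)
  · simp only [e]
    have h2 : Tendsto (fun n : ℕ => (qShiftedInf q (C * q ^ n * (U * q ^ k)))⁻¹) atTop (𝓝 1) := by
      have := (tendsto_qShiftedInf hq (C * (U * q ^ k))).inv₀ one_ne_zero
      simpa [mul_right_comm] using this
    simpa using (h2.const_mul (aaWeight q A B 0 D (U * q ^ k))).mul_const (q ^ k)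
  · rw [e, mul_right_comm, norm_mul]
    refine mul_le_mul_of_nonneg_left (hK ⟨n + k, ?_⟩) (norm_nonneg _)
    simp only [pow_add]
    congr 3
    ring

/-- The step `C ↦ C q` is iterated and the limit taken. -/
lemma jackson_aaWeight_zero (hq : ‖q‖ < 1) {A B C D : ℂ} (hA : A ≠ 0) (hB : B ≠ 0)
    (hAC : ∀ n : ℕ, A * C * q ^ n ≠ 1) (hAD : ∀ n : ℕ, A * D * q ^ n ≠ 1)
    (hBC : ∀ n : ℕ, B * C * q ^ n ≠ 1) (hBD : ∀ n : ℕ, B * D * q ^ n ≠ 1) :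
    qShiftedInf q (A * B * C * D) * jackson q A B (aaWeight q A B 0 D) =
      qShiftedInf q (A * C) * qShiftedInf q (B * C) * jackson q A B (aaWeight q A B C D) := by
  have hP (u : ℂ) := (multipliable_qShifted hq u).hasProd.tendsto_prod_nat
  have h1 (n : ℕ) : (∏ k ∈ Finset.range n, (1 - A * B * C * D * q ^ k)) *
      jackson q A B (aaWeight q A B (C * q ^ n) D) =
      (∏ k ∈ Finset.range n, (1 - A * C * q ^ k)) * (∏ k ∈ Finset.range n, (1 - B * C * q ^ k)) *
        jackson q A B (aaWeight q A B C D) := by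
    induction n with
    | zero => simp
    | succ n ih =>
      have h2 := jackson_aaWeight_step hq hA hB (C := C * q ^ n) (D := D)
        (fun m => by have := hAC (n + m); rw [pow_add] at this; convert this using 1; ring) hAD
        (fun m => by have := hBC (n + m); rw [pow_add] at this; convert this using 1; ring) hBD
      rw [Finset.prod_range_succ, Finset.prod_range_succ, Finset.prod_range_succ, pow_succ,
        ← mul_assoc C]
      linear_combination (∏ k ∈ Finset.range n, (1 - A * B * C * D * q ^ k)) * h2 +
        (1 - A * C * q ^ n) * (1 - B * C * q ^ n) * ih
  have hJ : Tendsto (fun n : ℕ => jackson q A B (aaWeight q A B (C * q ^ n) D)) atTop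
      (𝓝 (jackson q A B (aaWeight q A B 0 D))) :=
    (((tendsto_orbitSum_aaWeight hq A B D).const_mul B).sub
      ((tendsto_orbitSum_aaWeight hq A B D).const_mul A)).const_mul (1 - q)
  have h2 := (hP (A * B * C * D)).mul hJ
  simp only [h1] at h2
  exact tendsto_nhds_unique h2 (((hP (A * C)).mul (hP (B * C))).mul_const _)

lemma jackson_aaWeight_zero_zero (hq : ‖q‖ < 1) {A B C D : ℂ} (hA : A ≠ 0) (hB : B ≠ 0)
    (hAC : ∀ n : ℕ, A * C * q ^ n ≠ 1) (hAD : ∀ n : ℕ, A * D * q ^ n ≠ 1)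
    (hBC : ∀ n : ℕ, B * C * q ^ n ≠ 1) (hBD : ∀ n : ℕ, B * D * q ^ n ≠ 1) :
    qShiftedInf q (A * B * C * D) * jackson q A B (aaWeight q A B 0 0) =
      qShiftedInf q (A * C) * qShiftedInf q (B * C) * qShiftedInf q (A * D) *
        qShiftedInf q (B * D) * jackson q A B (aaWeight q A B C D) := by
  have h1 := jackson_aaWeight_zero hq hA hB hAC hAD hBC hBD
  have h2 := jackson_aaWeight_zero hq hA hB hAD (D := 0) (by simp) hBD (by simp)
  rw [mul_zero, qShiftedInf_zero_right, aaWeight_comm q A B D 0] at h2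
  linear_combination qShiftedInf q (A * B * C * D) * h2 +
    qShiftedInf q (A * D) * qShiftedInf q (B * D) * h1

/-- The weight for `B q` is `1 - t/B` times that for `B`, so it vanishes at `t = B` and the upper
limit may be moved. For `C = D = 0` the first moment is `A + B` times the integral, and `1 - (A +
B)/B = -A/B`. -/
lemma jackson_theta_shift (hq0 : q ≠ 0) (hq : ‖q‖ < 1) {A B : ℂ} (hA : A ≠ 0) (hB : B ≠ 0) :
    B * jackson q A (B * q) (aaWeight q A (B * q) 0 0) =
      -A * jackson q A B (aaWeight q A B 0 0) := by
  have hw := hasOrbitLimit_aaWeight hq A B 0 0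
  have hid (U : ℂ) : HasOrbitLimit q U fun t => t := .of_continuous hq continuous_id U
  rw [← jackson_shift hq (hasOrbitLimit_aaWeight hq _ _ _ _ _)
    (by rw [aaWeight_shift hq0 hq, div_self hB]; simp)]
  have h1 := jackson_aaWeight_moment hq hA hB (C := 0) (D := 0) (by simp) (by simp) (by simp)
    (by simp)
  have h3 := jackson_linear hq (hw A) (hw B) ((hid A).mul (hw A)) ((hid B).mul (hw B)) 1 (-B⁻¹)
  have h4 : jackson q A B (aaWeight q A (B * q) 0 0) = jackson q A B
      (fun t => 1 * aaWeight q A B 0 0 t + -B⁻¹ * (t * aaWeight q A B 0 0 t)) := by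
    congr 1; ext t; rw [aaWeight_shift hq0 hq]; ring
  rw [h4, h3]
  field_simp
  linear_combination -h1

/-- Quasi-periodicity carries the zero at `A = B` to every `B` in `A q ^ ℤ`. These are the cases
where the specialization used in `jackson_theta` is not admissible. -/
lemma jackson_theta_resonant (hq0 : q ≠ 0) (hq : ‖q‖ < 1) {A B : ℂ} (hA : A ≠ 0) (hB : B ≠ 0)
    {n : ℕ} (h : A * q ^ n = B ∨ B * q ^ n = A) : jackson q A B (aaWeight q A B 0 0) = 0 := by
  induction n generalizing B with
  | zero =>
    have : A = B := by rcases h with h | h <;> simpa [eq_comm] using h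
    subst this
    simp [jackson]
  | succ n ih =>
    rcases h with rfl | h
    · have hB' : A * q ^ n ≠ 0 := mul_ne_zero hA (pow_ne_zero _ hq0)
      have h1 := jackson_theta_shift hq0 hq hA hB'
      rw [ih hB' (.inl rfl), mul_zero, mul_assoc A (q ^ n) q, ← pow_succ] at h1
      exact (mul_eq_zero.1 h1).resolve_left hB'
    · have h1 := jackson_theta_shift hq0 hq hA hB
      rw [ih (mul_ne_zero hB hq0) (.inr (by rw [← h]; ring)), mul_zero] at h1
      exact (mul_eq_zero.1 h1.symm).resolve_left (neg_ne_zero.2 hA)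

lemma jackson_one (hq : ‖q‖ < 1) (A B : ℂ) : jackson q A B (fun _ => 1) = B - A := by
  have h : (1 : ℂ) - q ≠ 0 := fun e => by
    rw [← sub_eq_zero.1 e] at hq; simp at hq
  simp only [jackson, orbitSum, one_mul, tsum_geometric_of_norm_lt_one hq]
  field_simp

lemma pow_mul_self_ne_one (hq : ‖q‖ < 1) (n : ℕ) : q * q ^ n ≠ 1 := fun e => by
  have h := congrArg norm e
  rw [← pow_succ', norm_pow, norm_one] at h
  exact (pow_lt_one₀ (norm_nonneg q) hq n.succ_ne_zero).ne h

/-- For `C = q/A`, `D = q/B` the weight is identically 1 on both orbits, so the integral is `B - A`,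
and `jackson_aaWeight_zero_zero` can be solved for the integral with `C = D = 0`. At resonance both
sides vanish. -/
lemma jackson_theta (hq0 : q ≠ 0) (hq : ‖q‖ < 1) {A B : ℂ} (hA : A ≠ 0) (hB : B ≠ 0) :
    jackson q A B (aaWeight q A B 0 0) =
      B * (1 - q) * qShiftedInf q q * (qShiftedInf q (A / B) * qShiftedInf q (B * q / A)) := by
  by_cases h1 : ∃ n : ℕ, A * q ^ n = B
  · obtain ⟨n, h⟩ := h1
    rw [jackson_theta_resonant hq0 hq hA hB (.inl h),
      qShiftedInf_eq_zero hq (u := A / B) (n := n) (by rw [← h]; field_simp)]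
    simp
  by_cases h2 : ∃ n : ℕ, B * q ^ n = A
  · obtain ⟨n, h⟩ := h2
    rw [jackson_theta_resonant hq0 hq hA hB (.inr h)]
    -- For `n = 0` the first theta factor vanishes. Otherwise the second does, with index lowered by
    -- one because of the `q` in `B q / A`.
    rcases n with _ | n
    · rw [qShiftedInf_eq_zero hq (u := A / B) (n := 0) (by rw [← h]; field_simp)]
      simp
    · rw [qShiftedInf_eq_zero hq (u := B * q / A) (n := n) (by rw [← h]; field_simp; ring)]
      simp
  push Not at h1 h2
  have hqn := pow_mul_self_ne_one hq
  have e1 : A * (q / A) = q := by field_simp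
  have e2 : B * (q / B) = q := by field_simp
  have hAD (n : ℕ) : A * (q / B) * q ^ n ≠ 1 := fun e => h1 (n + 1) (by
    field_simp at e; rw [← e]; ring)
  have hBC (n : ℕ) : B * (q / A) * q ^ n ≠ 1 := fun e => h2 (n + 1) (by
    field_simp at e; rw [← e]; ring)
  have key := jackson_aaWeight_zero_zero hq hA hB (C := q / A) (D := q / B)
    (by rwa [e1]) hAD hBC (by rwa [e2])
  have hone : jackson q A B (aaWeight q A B (q / A) (q / B)) = B - A := by
    have hc (t : ℂ) (ht1 : qShiftedInf q (q / A * t) ≠ 0) (ht2 : qShiftedInf q (q / B * t) ≠ 0) :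
        aaWeight q A B (q / A) (q / B) t = 1 := by
      rw [aaWeight, mul_div_right_comm q t A, mul_div_right_comm q t B]
      exact div_self (mul_ne_zero ht1 ht2)
    rw [← jackson_one hq]
    have hs (X Y : ℂ) (h : ∀ n : ℕ, X * Y * q ^ n ≠ 1) (k : ℕ) :
        qShiftedInf q (Y * (X * q ^ k)) ≠ 0 := qShiftedInf_ne_zero hq fun n e =>
      h (k + n) (by rw [← e]; ring)
    refine jackson_congr (fun k => hc _ (hs _ _ ?_ k) (hs _ _ ?_ k))
      fun k => hc _ (hs _ _ ?_ k) (hs _ _ ?_ k)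
    · rwa [e1]
    · exact hAD
    · exact hBC
    · rwa [e2]
  rw [hone, show A * B * (q / A) * (q / B) = q * q by field_simp, e1, e2] at key
  have hqq : qShiftedInf q (q * q) ≠ 0 := qShiftedInf_ne_zero hq fun n e =>
    hqn (n + 1) (by rw [← e]; ring)
  apply mul_left_cancel₀ hqq
  rw [key, qShiftedInf_step hq (A / B), qShiftedInf_step hq q,
    show A * (q / B) = A / B * q by ring, show B * (q / A) = B * q / A by ring]
  field_simp

/-- The Andrews–Askey `q`-integral. -/
theorem jackson_aaWeight (hq0 : q ≠ 0) (hq : ‖q‖ < 1) {A B C D : ℂ} (hA : A ≠ 0) (hB : B ≠ 0)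
    (hAC : ∀ n : ℕ, A * C * q ^ n ≠ 1) (hAD : ∀ n : ℕ, A * D * q ^ n ≠ 1)
    (hBC : ∀ n : ℕ, B * C * q ^ n ≠ 1) (hBD : ∀ n : ℕ, B * D * q ^ n ≠ 1) :
    jackson q A B (aaWeight q A B C D) =
      B * (1 - q) * qShiftedInf q q * (qShiftedInf q (A / B) * qShiftedInf q (B * q / A)) *
        qShiftedInf q (A * B * C * D) /
      (qShiftedInf q (A * C) * qShiftedInf q (A * D) * qShiftedInf q (B * C) *
        qShiftedInf q (B * D)) := by
  have key := jackson_aaWeight_zero_zero hq hA hB hAC hAD hBC hBD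
  rw [jackson_theta hq0 hq hA hB] at key
  have h1 := qShiftedInf_ne_zero hq hAC
  have h2 := qShiftedInf_ne_zero hq hAD
  have h3 := qShiftedInf_ne_zero hq hBC
  have h4 := qShiftedInf_ne_zero hq hBD
  rw [eq_div_iff (by simp [h1, h2, h3, h4])]
  linear_combination -key

/-- The monic polynomial with zeros `B, B q, …, B q ^ (j - 1)`. -/
noncomputable def qNodal (q B : ℂ) (j : ℕ) : Polynomial ℂ :=
  ∏ k ∈ Finset.range j, (Polynomial.X - Polynomial.C (B * q ^ k))

lemma qNodal_succ (q B : ℂ) (j : ℕ) :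
    qNodal q B (j + 1) = (Polynomial.X - Polynomial.C B) * qNodal q (B * q) j := by
  rw [qNodal, Finset.prod_range_succ', mul_comm]
  simp [qNodal, pow_succ', mul_assoc]

lemma qNodal_monic (q B : ℂ) (j : ℕ) : (qNodal q B j).Monic :=
  Polynomial.monic_prod_of_monic _ _ fun _ _ => Polynomial.monic_X_sub_C _

lemma qNodal_natDegree (q B : ℂ) (j : ℕ) : (qNodal q B j).natDegree = j := by
  rw [qNodal, Polynomial.natDegree_prod_of_monic _ _ fun _ _ => Polynomial.monic_X_sub_C _]
  simp only [Polynomial.natDegree_X_sub_C]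
  simp

/-- The factor `t - B = -B (1 - t/B)` moves the weight from `B` to `B q`, and its zero at `B` moves
the upper limit too. At each step `theta_shift` turns the resulting constant into a factor `A`. -/
theorem jackson_qNodal_mul_aaWeight (hq0 : q ≠ 0) (hq : ‖q‖ < 1) {A B C D : ℂ} (hA : A ≠ 0)
    (hB : B ≠ 0) (hAC : ∀ n : ℕ, A * C * q ^ n ≠ 1) (hAD : ∀ n : ℕ, A * D * q ^ n ≠ 1)
    (hBC : ∀ n : ℕ, B * C * q ^ n ≠ 1) (hBD : ∀ n : ℕ, B * D * q ^ n ≠ 1) (j : ℕ) :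
    jackson q A B (fun t => (qNodal q B j).eval t * aaWeight q A B C D t) =
      A ^ j * (B * (1 - q) * qShiftedInf q q *
        (qShiftedInf q (A / B) * qShiftedInf q (B * q / A)) *
        qShiftedInf q (A * B * C * D * q ^ j)) /
      (qShiftedInf q (A * C) * qShiftedInf q (A * D) * qShiftedInf q (B * C * q ^ j) *
        qShiftedInf q (B * D * q ^ j)) := by
  induction j generalizing B with
  | zero => simpa [qNodal] using jackson_aaWeight hq0 hq hA hB hAC hAD hBC hBD
  | succ j ih =>
    have hp (j : ℕ) (B U : ℂ) : HasOrbitLimit q U fun t => (qNodal q B j).eval t :=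
      .of_continuous hq (qNodal q B j).continuous U
    rw [jackson_shift hq ((hp _ B B).mul (hasOrbitLimit_aaWeight hq _ _ _ _ _))
      (by simp [qNodal_succ])]
    have e : (fun t => (qNodal q B (j + 1)).eval t * aaWeight q A B C D t) =
        fun t => -B * ((qNodal q (B * q) j).eval t * aaWeight q A (B * q) C D t) := by
      ext t
      rw [aaWeight_shift hq0 hq, qNodal_succ]
      simp only [Polynomial.eval_mul, Polynomial.eval_sub, Polynomial.eval_X, Polynomial.eval_C]
      field_simp
      ring
    have hs (X : ℂ) (h : ∀ n : ℕ, B * X * q ^ n ≠ 1) (n : ℕ) : B * q * X * q ^ n ≠ 1 := fun e =>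
      h (n + 1) (by rw [← e]; ring)
    rw [e, jackson_const_mul, ih (mul_ne_zero hB hq0) (hs C hBC) (hs D hBD),
      show A * (B * q) * C * D * q ^ j = A * B * C * D * q ^ (j + 1) by ring,
      show B * q * C * q ^ j = B * C * q ^ (j + 1) by ring,
      show B * q * D * q ^ j = B * D * q ^ (j + 1) by ring]
    rw [← mul_div_assoc]
    congr 1
    linear_combination A ^ j * B * (1 - q) * qShiftedInf q q *
      qShiftedInf q (A * B * C * D * q ^ (j + 1)) * theta_shift hq0 hq hA hB

end Jackson

/-! ### Multiple integrals and determinants -/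

section Multi

variable {q : ℂ}

lemma summable_norm_prod_pi {r : ℕ} {F : Fin r → ℕ → ℂ} (hF : ∀ i, Summable fun k => ‖F i k‖) :
    Summable (fun k : Fin r → ℕ => ‖∏ i, F i (k i)‖) ∧
      ∑' k : Fin r → ℕ, ∏ i, F i (k i) = ∏ i, ∑' k, F i k := by
  induction r with
  | zero => exact ⟨(hasSum_fintype _).summable, by simp⟩
  | succ r ih =>
    obtain ⟨h1, h2⟩ := ih fun i => hF i.succ
    let e := Fin.consEquiv fun _ : Fin (r + 1) => ℕ
    have he (p : ℕ × (Fin r → ℕ)) :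
        ∏ i, F i (e p i) = F 0 p.1 * ∏ i : Fin r, F i.succ (p.2 i) := by
      rw [Fin.prod_univ_succ]
      rfl
    constructor
    · rw [← e.summable_iff]
      refine (summable_mul_of_summable_norm (hF 0) h1).norm.congr fun p => ?_
      simp only [Function.comp_apply, he]
    · rw [← e.tsum_eq, Fin.prod_univ_succ, ← h2, tsum_mul_tsum_of_summable_norm (hF 0) h1]
      exact tsum_congr he

lemma prod_apply_qNode {r : ℕ} (A B : Fin r → ℂ) (g : Fin r → ℂ → ℂ) (S : Finset (Fin r))
    (k : Fin r → ℕ) : (∏ i, g i (qNode q A B S k i)) * q ^ (∑ i, k i) =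
      ∏ i, g i ((if i ∈ S then A i else B i) * q ^ k i) * q ^ k i := by
  rw [Finset.prod_mul_distrib, Finset.prod_pow_eq_pow_sum]
  rfl

lemma summable_norm_apply_ite (hq : ‖q‖ < 1) {r : ℕ} {A B : Fin r → ℂ} {g : Fin r → ℂ → ℂ}
    (hA : ∀ i, HasOrbitLimit q (A i) (g i)) (hB : ∀ i, HasOrbitLimit q (B i) (g i))
    (S : Finset (Fin r)) (i : Fin r) : Summable fun k : ℕ =>
      ‖g i ((if i ∈ S then A i else B i) * q ^ k) * q ^ k‖ := by
  split_ifs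
  · exact (hA i).summable_norm hq
  · exact (hB i).summable_norm hq

lemma multiQIntegrable_prod (hq : ‖q‖ < 1) {r : ℕ} {A B : Fin r → ℂ} {g : Fin r → ℂ → ℂ}
    (hA : ∀ i, HasOrbitLimit q (A i) (g i)) (hB : ∀ i, HasOrbitLimit q (B i) (g i)) :
    MultiQIntegrable q A B fun t => ∏ i, g i (t i) := fun S => by
  simp only [prod_apply_qNode]
  exact (summable_norm_prod_pi (summable_norm_apply_ite hq hA hB S)).1

/-- Fubini's theorem for a product integrand. -/
lemma multiQIntegral_prod (hq : ‖q‖ < 1) {r : ℕ} {A B : Fin r → ℂ} {g : Fin r → ℂ → ℂ}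
    (hA : ∀ i, HasOrbitLimit q (A i) (g i)) (hB : ∀ i, HasOrbitLimit q (B i) (g i)) :
    multiQIntegral q A B (fun t => ∏ i, g i (t i)) = ∏ i, jackson q (A i) (B i) (g i) := by
  have h1 (S : Finset (Fin r)) := (summable_norm_prod_pi (summable_norm_apply_ite hq hA hB S)).2
  have h2 (S : Finset (Fin r)) (i : Fin r) :
      ∑' k : ℕ, g i ((if i ∈ S then A i else B i) * q ^ k) * q ^ k =
        if i ∈ S then orbitSum q (A i) (g i) else orbitSum q (B i) (g i) := by
    split_ifs <;> rfl
  simp only [multiQIntegral, prod_apply_qNode, h1, h2]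
  have h3 (i : Fin r) : jackson q (A i) (B i) (g i) =
      (1 - q) * (-A i * orbitSum q (A i) (g i) + B i * orbitSum q (B i) (g i)) := by
    rw [jackson]; ring
  -- Expanding the product of the two-term sums indexes the terms by the set `S` of coordinates
  -- taken at `A`.
  simp only [h3, Finset.prod_mul_distrib, Finset.prod_add, Finset.prod_const, Finset.card_univ,
    Fintype.card_fin, Finset.powerset_univ]
  rw [Finset.mul_sum]
  refine Finset.sum_congr rfl fun S _ => ?_
  rw [Finset.prod_ite, Finset.filter_mem_eq_inter, Finset.univ_inter, Finset.filter_notMem_eq_sdiff,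
    ← Finset.compl_eq_univ_sdiff]
  ring

lemma MultiQIntegrable.sum {r : ℕ} {A B : Fin r → ℂ} {ι : Type*} [Fintype ι] {c : ι → ℂ}
    {f : ι → (Fin r → ℂ) → ℂ} (hf : ∀ s, MultiQIntegrable q A B (f s)) :
    MultiQIntegrable q A B fun t => ∑ s, c s * f s t := fun S => by
  refine Summable.norm ?_
  simp only [Finset.sum_mul, mul_assoc]
  exact summable_sum fun s _ => (hf s S).of_norm.mul_left (c s)

lemma multiQIntegral_sum {r : ℕ} {A B : Fin r → ℂ} {ι : Type*} [Fintype ι] {c : ι → ℂ}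
    {f : ι → (Fin r → ℂ) → ℂ} (hf : ∀ s, MultiQIntegrable q A B (f s)) :
    multiQIntegral q A B (fun t => ∑ s, c s * f s t) =
      ∑ s, c s * multiQIntegral q A B (f s) := by
  have h (S : Finset (Fin r)) : ∑' k : Fin r → ℕ,
      (∑ s, c s * f s (qNode q A B S k)) * q ^ (∑ i, k i) =
      ∑ s, c s * ∑' k : Fin r → ℕ, f s (qNode q A B S k) * q ^ (∑ i, k i) := by
    simp only [Finset.sum_mul, mul_assoc]
    rw [Summable.tsum_finsetSum fun s _ => (hf s S).of_norm.mul_left (c s)]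
    simp only [tsum_mul_left]
  simp only [multiQIntegral, h, Finset.mul_sum]
  rw [Finset.sum_comm]
  refine Finset.sum_congr rfl fun s _ => Finset.sum_congr rfl fun S _ => ?_
  ring

/-- A determinant of one-variable functions integrates to the determinant of the integrals. -/
lemma multiQIntegral_det (hq : ‖q‖ < 1) {r : ℕ} {A B : Fin r → ℂ} {g : Fin r → Fin r → ℂ → ℂ}
    (hA : ∀ i j, HasOrbitLimit q (A i) (g i j)) (hB : ∀ i j, HasOrbitLimit q (B i) (g i j)) :
    MultiQIntegrable q A B (fun t => (Matrix.of fun i j => g i j (t i)).det) ∧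
      multiQIntegral q A B (fun t => (Matrix.of fun i j => g i j (t i)).det) =
        (Matrix.of fun i j => jackson q (A i) (B i) (g i j)).det := by
  have hd (M : Fin r → Fin r → ℂ) : (Matrix.of fun i j => M i j).det =
      ∑ σ : Equiv.Perm (Fin r), ((Equiv.Perm.sign σ : ℤ) : ℂ) * ∏ i, M i (σ i) := by
    rw [← Matrix.det_transpose, Matrix.det_apply']
    rfl
  have hi (σ : Equiv.Perm (Fin r)) :=
    multiQIntegrable_prod hq (fun i => hA i (σ i)) fun i => hB i (σ i)
  simp only [hd]
  refine ⟨MultiQIntegrable.sum hi, ?_⟩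
  rw [multiQIntegral_sum hi]
  exact Finset.sum_congr rfl fun σ _ => by
    rw [multiQIntegral_prod hq (fun i => hA i (σ i)) fun i => hB i (σ i)]

/-- The determinant of values of polynomials `X ^ j * p j`, `p j (0) = 1`, of degree `< r`. -/
lemma det_eval_X_pow_mul {r : ℕ} (z : Fin r → ℂ) (p : Fin r → Polynomial ℂ)
    (h0 : ∀ j, (p j).coeff 0 = 1) (hdeg : ∀ j : Fin r, (Polynomial.X ^ (j : ℕ) * p j).natDegree < r) :
    (Matrix.of fun i j : Fin r => (Polynomial.X ^ (j : ℕ) * p j).eval (z i)).det =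
      (Matrix.vandermonde z).det := by
  have h : (Matrix.of fun i j : Fin r => (Polynomial.X ^ (j : ℕ) * p j).eval (z i)) =
      Matrix.vandermonde z *
        Matrix.of fun l j : Fin r => (Polynomial.X ^ (j : ℕ) * p j).coeff l := by
    ext i j
    rw [Matrix.mul_apply, Matrix.of_apply, Polynomial.eval_eq_sum_range' (hdeg j), Finset.sum_range]
    exact Finset.sum_congr rfl fun l _ => by
      rw [Matrix.vandermonde_apply, Matrix.of_apply, mul_comm]
  -- The coefficient of `X ^ l` in `X ^ j * p j` vanishes for `l < j` and is `p j (0) = 1` for `l =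
  -- j`.
  have h1 : (Matrix.of fun l j : Fin r => (Polynomial.X ^ (j : ℕ) * p j).coeff l).det = 1 := by
    rw [Matrix.det_of_isLowerTriangular]
    · exact Finset.prod_eq_one fun j _ => by simp [Polynomial.coeff_X_pow_mul', h0]
    · intro l j hlj
      have : (l : ℕ) < j := hlj
      rw [Matrix.of_apply, Polynomial.coeff_X_pow_mul', if_neg (by omega)]
  rw [h, Matrix.det_mul, h1, mul_one]

/-- Column `j` evaluates a polynomial of degree at most `j + (r - 1 - j) = r - 1` whose lowest term
is `X ^ j`, so `det_eval_X_pow_mul` applies. -/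
lemma det_pow_mul_prod {r : ℕ} (q e : ℂ) (z : Fin r → ℂ) :
    (Matrix.of fun i j : Fin r => z i ^ (j : ℕ) *
      ∏ k ∈ Finset.range (r - 1 - j), (1 - z i * e * q ^ (j : ℕ) * q ^ k)).det =
      (Matrix.vandermonde z).det := by
  rw [← det_eval_X_pow_mul z (fun j => ∏ k ∈ Finset.range (r - 1 - j),
    (1 - Polynomial.C (e * q ^ (j : ℕ) * q ^ k) * Polynomial.X))]
  · congr 1
    ext i j
    simp only [Matrix.of_apply, Polynomial.eval_mul, Polynomial.eval_pow, Polynomial.eval_X,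
      Polynomial.eval_prod, Polynomial.eval_sub, Polynomial.eval_one, Polynomial.eval_C]
    congr 1
    exact Finset.prod_congr rfl fun k _ => by ring
  · intro j
    rw [Polynomial.coeff_zero_prod]
    exact Finset.prod_eq_one fun k _ => by simp
  · intro j
    have hj := j.2
    have h1 : (∏ k ∈ Finset.range (r - 1 - j),
        (1 - Polynomial.C (e * q ^ (j : ℕ) * q ^ k) * Polynomial.X)).natDegree ≤ r - 1 - j := by
      refine (Polynomial.natDegree_prod_le _ _).trans ?_
      refine (Finset.sum_le_card_nsmul _ _ 1 fun k _ => ?_).trans (by simp)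
      compute_degree
    have h2 := Polynomial.natDegree_mul_le_of_le (Polynomial.natDegree_X_pow_le (R := ℂ) j) h1
    omega

lemma prod_prod_Ioi_const_mul {r : ℕ} (c : ℂ) (f : Fin r → Fin r → ℂ) :
    ∏ i, ∏ j ∈ Finset.Ioi i, c * f i j = c ^ r.choose 2 * ∏ i, ∏ j ∈ Finset.Ioi i, f i j := by
  simp only [Finset.prod_mul_distrib, Finset.prod_const, Fin.card_Ioi]
  rw [Finset.prod_pow_eq_pow_sum, Fin.sum_univ_eq_sum_range (fun i => r - 1 - i) r,
    Finset.sum_range_reflect (fun i => i), Finset.sum_range_id, Nat.choose_two_right]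

lemma prod_prod_Ioi_sub {r : ℕ} (z : Fin r → ℂ) : ∏ i, ∏ j ∈ Finset.Ioi i, (z i - z j) =
    (-1) ^ r.choose 2 * (Matrix.vandermonde z).det := by
  rw [Matrix.det_vandermonde, ← prod_prod_Ioi_const_mul]
  simp

lemma MultiQIntegrable.const_mul {r : ℕ} {A B : Fin r → ℂ} {f : (Fin r → ℂ) → ℂ}
    (hf : MultiQIntegrable q A B f) (c : ℂ) : MultiQIntegrable q A B fun t => c * f t := by
  simpa using MultiQIntegrable.sum (ι := Unit) (c := fun _ => c) fun _ => hf

lemma multiQIntegral_const_mul {r : ℕ} {A B : Fin r → ℂ} {f : (Fin r → ℂ) → ℂ}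
    (hf : MultiQIntegrable q A B f) (c : ℂ) :
    multiQIntegral q A B (fun t => c * f t) = c * multiQIntegral q A B f := by
  simpa using multiQIntegral_sum (ι := Unit) (c := fun _ => c) fun _ => hf

/-- Monic polynomials of degrees `0, …, r - 1` have the Vandermonde determinant; the weight in `t_i`
is absorbed into row `i`. The sign comes from `t_i - t_j` against `t_j - t_i`. -/
lemma andrewsAskeyIntegrand_eq_det {r : ℕ} (q a b c d : ℂ) (x t : Fin r → ℂ) :
    andrewsAskeyIntegrand q a b c d x t = (-1) ^ r.choose 2 *
      (Matrix.of fun i j : Fin r => (qNodal q b j).eval (t i) *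
        aaWeight q (-(a * x i)) b (-c / a) (d / b) (t i)).det := by
  have h := Matrix.det_eval_matrixOfPolynomials_eq_det_vandermonde t
    (fun j : Fin r => qNodal q b j) (fun j => qNodal_natDegree q b j) fun j => qNodal_monic q b j
  rw [andrewsAskeyIntegrand, prod_prod_Ioi_sub, h, mul_assoc, mul_comm (Matrix.det _),
    ← Matrix.det_mul_column]
  congr 3
  ext i j
  simp only [Matrix.of_apply]
  rw [mul_comm, aaWeight,
    show -(q * t i) / (a * x i) = q * t i / -(a * x i) by rw [div_neg, neg_div],
    show -(c * t i) / a = -c / a * t i by ring, show d * t i / b = d / b * t i by ring]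

/-- The determinant of the Andrews–Askey integrals of the nodal polynomials. -/
lemma det_jackson_qNodal {r : ℕ} (hq0 : q ≠ 0) (hq : ‖q‖ < 1) {A : Fin r → ℂ} {B C D : ℂ}
    (hA : ∀ i, A i ≠ 0) (hB : B ≠ 0) (hAC : ∀ i, ∀ n : ℕ, A i * C * q ^ n ≠ 1)
    (hAD : ∀ i, ∀ n : ℕ, A i * D * q ^ n ≠ 1)
    (hBC : ∀ n : ℕ, B * C * q ^ n ≠ 1) (hBD : ∀ n : ℕ, B * D * q ^ n ≠ 1) :
    (Matrix.of fun i j : Fin r => jackson q (A i) B fun t =>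
      (qNodal q B j).eval t * aaWeight q (A i) B C D t).det =
      (∏ i : Fin r, B * (1 - q) * (qShiftedInf q q * qShiftedInf q (A i / B) *
        qShiftedInf q (B * q / A i) * qShiftedInf q (A i * (B * C * D) * q ^ (r - 1))) /
        (qShiftedInf q (A i * C) * qShiftedInf q (A i * D) * qShiftedInf q (B * C * q ^ (i : ℕ)) *
          qShiftedInf q (B * D * q ^ (i : ℕ)))) * (Matrix.vandermonde A).det := by
  rw [← det_pow_mul_prod q (B * C * D) A]
  simp only [div_eq_mul_inv, mul_inv, ← mul_assoc]
  -- The factors free of `A i` are split off: they are absorbed as column factors, the others as row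
  -- factors.
  rw [show (∏ i : Fin r, B * (1 - q) * qShiftedInf q q * qShiftedInf q (A i * B⁻¹) *
        qShiftedInf q (B * q * (A i)⁻¹) * qShiftedInf q (A i * B * C * D * q ^ (r - 1)) *
        (qShiftedInf q (A i * C))⁻¹ * (qShiftedInf q (A i * D))⁻¹ *
        (qShiftedInf q (B * C * q ^ (i : ℕ)))⁻¹ * (qShiftedInf q (B * D * q ^ (i : ℕ)))⁻¹) =
      (∏ i : Fin r, B * (1 - q) * qShiftedInf q q * qShiftedInf q (A i * B⁻¹) *
        qShiftedInf q (B * q * (A i)⁻¹) * qShiftedInf q (A i * B * C * D * q ^ (r - 1)) *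
        (qShiftedInf q (A i * C))⁻¹ * (qShiftedInf q (A i * D))⁻¹) *
      ∏ i : Fin r, (qShiftedInf q (B * C * q ^ (i : ℕ)))⁻¹ *
        (qShiftedInf q (B * D * q ^ (i : ℕ)))⁻¹ by
    rw [← Finset.prod_mul_distrib]; exact Finset.prod_congr rfl fun i _ => by ring,
    mul_assoc, ← Matrix.det_mul_row, ← Matrix.det_mul_column]
  congr 1
  ext i j
  simp only [Matrix.of_apply]
  rw [jackson_qNodal_mul_aaWeight hq0 hq (hA i) hB (hAC i) (hAD i) hBC hBD,
    qShiftedInf_eq_prod_mul hq (A i * B * C * D * q ^ (j : ℕ)) (r - 1 - j),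
    show A i * B * C * D * q ^ (j : ℕ) * q ^ (r - 1 - j) = A i * B * C * D * q ^ (r - 1) by
      rw [mul_assoc _ (q ^ (j : ℕ)), ← pow_add, Nat.add_sub_cancel' (by omega)]]
  simp only [div_eq_mul_inv, mul_inv]
  ring

end Multi

/-! ### Evaluation of the multiple integral -/

theorem corollary6p3 (r : ℕ) (q a b c d : ℂ) (x : Fin r → ℂ)
    (hq0 : 0 < ‖q‖) (hq1 : ‖q‖ < 1)
    (ha : a ≠ 0) (hb : b ≠ 0) (hx : ∀ i, x i ≠ 0)
    -- no zero in a denominator, at any of the nodes `t_i = -a x_i q ^ n`, `t_i = b q ^ n`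
    (hcx : ∀ i, ∀ n : ℕ, c * x i * q ^ n ≠ 1)
    (hadx : ∀ i, ∀ n : ℕ, -(a * d * x i) / b * q ^ n ≠ 1)
    (hbc : ∀ n : ℕ, -(b * c) / a * q ^ n ≠ 1)
    (hd : ∀ n : ℕ, d * q ^ n ≠ 1) :
    MultiQIntegrable q (fun i => -(a * x i)) (fun _ => b)
        (andrewsAskeyIntegrand q a b c d x) ∧
    multiQIntegral q (fun i => -(a * x i)) (fun _ => b)
        (andrewsAskeyIntegrand q a b c d x) =
      (-a) ^ r.choose 2 * b ^ r * (1 - q) ^ r *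
        (∏ i, ∏ j ∈ Finset.Ioi i, (x i - x j)) *
        ∏ i : Fin r,
          (qShiftedInf q q * qShiftedInf q (-(a * x i) / b) *
              qShiftedInf q (-(b * q) / (a * x i)) *
              qShiftedInf q (c * d * q ^ (r - 1) * x i)) /
            (qShiftedInf q (c * x i) * qShiftedInf q (-(a * d * x i) / b) *
              qShiftedInf q (-(b * c * q ^ (i : ℕ)) / a) *
              qShiftedInf q (d * q ^ (i : ℕ))) := by
  have hq : q ≠ 0 := norm_pos_iff.1 hq0
  have hA (i : Fin r) : -(a * x i) ≠ 0 := neg_ne_zero.2 (mul_ne_zero ha (hx i))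
  have eAC (i : Fin r) : -(a * x i) * (-c / a) = c * x i := by field_simp
  have eAD (i : Fin r) : -(a * x i) * (d / b) = -(a * d * x i) / b := by ring
  have eBC : b * (-c / a) = -(b * c) / a := by ring
  have eBD : b * (d / b) = d := by field_simp
  have hlim (i j : Fin r) (U : ℂ) : HasOrbitLimit q U fun t => (qNodal q b j).eval t *
      aaWeight q (-(a * x i)) b (-c / a) (d / b) t :=
    (HasOrbitLimit.of_continuous hq1 (qNodal q b j).continuous U).mul
      (hasOrbitLimit_aaWeight hq1 _ _ _ _ U)
  obtain ⟨h1, h2⟩ := multiQIntegral_det hq1 (A := fun i => -(a * x i)) (B := fun _ => b)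
    (fun i j => hlim i j _) fun i j => hlim i j _
  have hf : andrewsAskeyIntegrand q a b c d x = _ :=
    funext (andrewsAskeyIntegrand_eq_det q a b c d x)
  rw [hf]
  refine ⟨h1.const_mul _, ?_⟩
  rw [multiQIntegral_const_mul h1, h2, det_jackson_qNodal hq hq1 hA hb
    (fun i => by rw [eAC]; exact hcx i) (fun i => by rw [eAD]; exact hadx i)
    (by rwa [eBC]) (by rwa [eBD]), mul_left_comm, ← prod_prod_Ioi_sub]
  -- The sign and the Vandermonde determinant have recombined into the product of the `A i - A j`;
  -- each factor contributes `-a`.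
  have hs : ∏ i, ∏ j ∈ Finset.Ioi i, (-(a * x i) - -(a * x j)) =
      (-a) ^ r.choose 2 * ∏ i, ∏ j ∈ Finset.Ioi i, (x i - x j) := by
    rw [← prod_prod_Ioi_const_mul]
    exact Finset.prod_congr rfl fun i _ => Finset.prod_congr rfl fun j _ => by ring
  have hc : b ^ r * (1 - q) ^ r = ∏ _i : Fin r, b * (1 - q) := by
    simp [mul_pow]
  have hi (i : Fin r) : b * (1 - q) * (qShiftedInf q q * qShiftedInf q (-(a * x i) / b) *
        qShiftedInf q (b * q / -(a * x i)) *
        qShiftedInf q (-(a * x i) * (b * (-c / a) * (d / b)) * q ^ (r - 1))) /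
      (qShiftedInf q (-(a * x i) * (-c / a)) * qShiftedInf q (-(a * x i) * (d / b)) *
        qShiftedInf q (b * (-c / a) * q ^ (i : ℕ)) * qShiftedInf q (b * (d / b) * q ^ (i : ℕ))) =
      b * (1 - q) * ((qShiftedInf q q * qShiftedInf q (-(a * x i) / b) *
          qShiftedInf q (-(b * q) / (a * x i)) * qShiftedInf q (c * d * q ^ (r - 1) * x i)) /
        (qShiftedInf q (c * x i) * qShiftedInf q (-(a * d * x i) / b) *
          qShiftedInf q (-(b * c * q ^ (i : ℕ)) / a) * qShiftedInf q (d * q ^ (i : ℕ)))) := by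
    rw [eAC, eAD, eBC, eBD, show -(b * c) / a * q ^ (i : ℕ) = -(b * c * q ^ (i : ℕ)) / a by ring,
      show b * q / -(a * x i) = -(b * q) / (a * x i) by rw [div_neg, neg_div],
      show -(a * x i) * (-(b * c) / a * (d / b)) * q ^ (r - 1) = c * d * q ^ (r - 1) * x i by
        field_simp,
      mul_div_assoc]
  rw [hs, mul_assoc ((-a) ^ r.choose 2), hc, Finset.prod_congr rfl fun i _ => hi i,
    Finset.prod_mul_distrib]
  ring
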